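/- A partition is strict if its parts are pairwise distinct. Let $\lambda=(\lambda_1>\dots>\lambda_\ell>0)$ be a strict partition (possibly empty). Its shifted Young diagram $S(\lambda)$ is obtained from the Young diagram of $\lambda$ by shifting the $i$th row $i-1$ boxes to the right, for each $i$. The shifted hook length of the box $(i,j)$ (row $i$, column $j$) of $S(\lambda)$ is the number of boxes of $S(\lambda)$ to its right in row $i$ or below it in column $j$, plus one for the box itself, plus the number of boxes in row $j+1$ of $S(\lambda)$. For a positive integer $s$, $\lambda$ is an $s$-core shifted Young diagram ($s$-CSYD) if no shifted hook length of $S(\lambda)$ is divisible by $s$; it is an $(s,t)$-CSYD if it is both an $s$-CSYD and a $t$-CSYD. The doubled distinct partition $\lambda\lambda$ of $\lambda$ is the partition with Frobenius symbol $\begin{pmatrix}\lambda_1&\cdots&\lambda_\ell\\ \lambda_1-1&\cdots&\lambda_\ell-1\end{pmatrix}$ (arm lengths of the diagonal boxes above, leg lengths below). It is a doubled distinct $(s,t)$-core if none of its (ordinary) hook lengths is divisible by $s$ or by $t$. **Theorem.** Let $s$ and $t$ be coprime positive integers. There are finitely many doubled distinct $(s,t)$-cores and finitely many $(s,t)$-CSYDs.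 The number of doubled distinct $(s,t)$-cores is $$\binom{\lfloor (s-1)/2\rfloor+\lfloor (t-1)/2\rfloor}{\lfloor (s-1)/2\rfloor},$$ and, if $(s,t)\neq(1,1)$, the number of $(s,t)$-CSYDs is $$\binom{\lfloor (s-1)/2\rfloor+\lfloor t/2\rfloor-1}{\lfloor (s-1)/2\rfloor}+\binom{\lfloor s/2\rfloor+\lfloor (t-1)/2\rfloor-1}{\lfloor (t-1)/2\rfloor},$$ where $\binom{n}{k}=0$ for $n<0$. -/

import Mathlib

namespace ShiftedCores

/-!
Partitions are Mathlib's `YoungDiagram`s; rows and columns are indexed from `0`, so the box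
`(i, j)` here is the box usually written `(i + 1, j + 1)`, and the parts of `μ` are
`μ.rowLen 0 ≥ μ.rowLen 1 ≥ …`, collected (without the zeros) in the list `μ.rowLens`.
-/

/-- A partition is strict if its parts are pairwise distinct. -/
def IsStrict (μ : YoungDiagram) : Prop :=
  μ.rowLens.Nodup

/-- For a finite set `D` of boxes, the number of boxes of `D` to the right of `(i, j)` in its row,
plus the number of boxes of `D` below `(i, j)` in its column, plus one for the box itself. -/
def hookLength (D : Finset (ℕ × ℕ)) (i j : ℕ) : ℕ :=
  (D.filter fun c => c.1 = i ∧ j < c.2).card + (D.filter fun c => c.2 = j ∧ i < c.1).card + 1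

/-- A partition is an `s`-core if none of its hook lengths is divisible by `s`. -/
def IsCore (s : ℕ) (μ : YoungDiagram) : Prop :=
  ∀ i j : ℕ, (i, j) ∈ μ → ¬ s ∣ hookLength μ.cells i j

/-- The boxes of the shifted Young diagram `S(μ)`: row `i` is moved `i` places to the right. -/
def shiftedCells (μ : YoungDiagram) : Finset (ℕ × ℕ) :=
  μ.cells.image fun c => (c.1, c.1 + c.2)

/-- The shifted hook length of the box `(i, j)` in `S(μ)`: the boxes on its right, below it, the box
itself, and all the boxes in row `j + 1` of `S(μ)`. -/
def shiftedHookLength (μ : YoungDiagram) (i j : ℕ) : ℕ :=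
  hookLength (shiftedCells μ) i j + ((shiftedCells μ).filter fun c => c.1 = j + 1).card

/-- The shifted Young diagram of `μ` is an `s`-core shifted Young diagram: `μ` is strict and no
shifted hook length of `S(μ)` is divisible by `s`. -/
def IsCSYD (s : ℕ) (μ : YoungDiagram) : Prop :=
  IsStrict μ ∧ ∀ i j : ℕ, (i, j) ∈ shiftedCells μ → ¬ s ∣ shiftedHookLength μ i j

/-- The boxes of the doubled distinct diagram. A new column is placed on the left of `S(μ)`, so that
the box `(i, j)` of `S(μ)` becomes `(i, j + 1)`; then, for every row index `i`, `μ.rowLen i` boxes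
are added to column `i`, in the rows `i, i + 1, …, i + μ.rowLen i - 1`. -/
def doubledCells (μ : YoungDiagram) : Finset (ℕ × ℕ) :=
  ((shiftedCells μ).image fun c => (c.1, c.2 + 1)) ∪ μ.cells.image fun c => (c.1 + c.2, c.1)

theorem mem_doubledCells (μ : YoungDiagram) (i j : ℕ) :
    (i, j) ∈ doubledCells μ ↔
      (i < j ∧ j ≤ i + μ.rowLen i) ∨ (j ≤ i ∧ i < j + μ.rowLen j) := by
  simp only [doubledCells, shiftedCells, Finset.mem_union, Finset.mem_image, Prod.exists,
    YoungDiagram.mem_cells, YoungDiagram.mem_iff_lt_rowLen, Prod.mk.injEq]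
  constructor
  · rintro (⟨a, b, ⟨c, d, h, rfl, rfl⟩, rfl, rfl⟩ | ⟨a, b, h, rfl, rfl⟩)
    · left; omega
    · right; omega
  · rintro (⟨h1, h2⟩ | ⟨h1, h2⟩)
    · exact Or.inl ⟨i, j - 1, ⟨i, j - 1 - i, by omega, rfl, by omega⟩, rfl, by omega⟩
    · exact Or.inr ⟨j, i - j, by omega, by omega, rfl⟩

theorem IsStrict.rowLen_succ_lt {μ : YoungDiagram} (h : IsStrict μ) (i : ℕ)
    (hi : 0 < μ.rowLen (i + 1)) : μ.rowLen (i + 1) < μ.rowLen i := by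
  refine lt_of_le_of_ne (μ.rowLen_anti i (i + 1) (Nat.le_succ i)) fun he => ?_
  have h1 : i + 1 < μ.rowLens.length := by
    rw [YoungDiagram.length_rowLens, ← YoungDiagram.mem_iff_lt_colLen,
      YoungDiagram.mem_iff_lt_rowLen]
    exact hi
  have h0 : i < μ.rowLens.length := by omega
  have := (List.Nodup.getElem_inj_iff h (hi := h1) (hj := h0)).1 (by
    rw [YoungDiagram.get_rowLens, YoungDiagram.get_rowLens]; exact he)
  omega

theorem IsStrict.add_rowLen_le {μ : YoungDiagram} (h : IsStrict μ) {i k : ℕ} (hik : i ≤ k)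
    (hk : 0 < μ.rowLen k) : k + μ.rowLen k ≤ i + μ.rowLen i := by
  induction k, hik using Nat.le_induction with
  | base => exact le_rfl
  | succ k hik ih =>
    have h1 := h.rowLen_succ_lt k hk
    have h2 := ih (by omega)
    omega

/-- The doubled distinct partition of a strict partition. -/
def doubled (μ : YoungDiagram) (h : IsStrict μ) : YoungDiagram where
  cells := doubledCells μ
  isLowerSet := by
    rintro ⟨i, j⟩ ⟨a, b⟩ hle hij
    obtain ⟨hai, hbj⟩ : a ≤ i ∧ b ≤ j := hle
    rw [Finset.mem_coe, mem_doubledCells] at hij ⊢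
    rcases hij with ⟨h1, h2⟩ | ⟨h1, h2⟩ <;> rcases lt_or_ge a b with hab | hab
    · have := h.add_rowLen_le hai (by omega)
      omega
    · have := h.add_rowLen_le (hab.trans hai) (by omega)
      omega
    · have := h.add_rowLen_le (hab.le.trans hbj) (by omega)
      omega
    · have := h.add_rowLen_le hbj (by omega)
      omega

/-- The set of doubled distinct `(s, t)`-cores. -/
def DD (s t : ℕ) : Set YoungDiagram :=
  {ν | (∃ (μ : YoungDiagram) (h : IsStrict μ), ν = doubled μ h) ∧ IsCore s ν ∧ IsCore t ν}

/-- The set of `(s, t)`-CSYDs; the shifted diagram `S(μ)` is identified with the strict partition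
`μ`. -/
def CS (s t : ℕ) : Set YoungDiagram :=
  {μ | IsCSYD s μ ∧ IsCSYD t μ}

/-- The binomial coefficient with integer upper entry, with the convention that it is `0` when the
upper entry is negative. -/
def binom (n : ℤ) (k : ℕ) : ℕ :=
  if n < 0 then 0 else n.toNat.choose k

end ShiftedCores

/-!
A strict partition is encoded by the set `X` of its parts. The hook lengths of its shifted diagram
in the row of the part `x` are the sums `x + y` with smaller parts `y` and the differences `x - g`
with `0 ≤ g < x` not a part; its doubled distinct diagram has the same hook lengths together with
the numbers `2 * x` (`IsStrict.forall_shiftedHookLength_iff`, `IsStrict.isCore_doubled_iff`). So the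
core conditions say that `X` is closed under `x ↦ x - s` for `x ≥ s`, does not contain `0`, and that
no sum of two elements is a multiple of `s`, where for CSYDs the two elements have to be distinct
(`IsShiftedSet`) and for doubled distinct cores they need not be (`IsDoubledSet`).

Extend `X` to a set `M` of integers by `0 ∈ M` and `-z ∈ M ↔ z ∉ M` for `z ≠ 0` (`symmetrize`). Then
`X` is a doubled `s`-core exactly if `M` is closed under subtracting `s` (`isDoubledSet_iff`). Let
`n = s + t`. If `M` is closed under subtracting both `s` and `t`, and `c j` denotes the least `k`
with `j * s - n * k ∈ M`, then `c (j + 1) - c j` is `0` or `1`, and these numbers determine `M`,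
because every integer is `j * s - n * k` for a unique `0 ≤ j < n`. Thus `M` is cut out by a lattice
path with `n` increments, `s` of which are equal to `1` (`exists_isPath`, `IsPath.pathParts_mem`).
The symmetry of `M` becomes `c j + c (n - j) = s + 1` for `0 < j < n`; it forces `c 1 = 1` and
`c (n - 1) = s`, and makes the sequence of the increments in between a palindrome. The path is therefore
given by its `n / 2 - 1` increments between `1` and `n / 2`, of which exactly `(s - 1) / 2` are `1`,
and any choice of these is possible (`bijOn_pathParts`). This counts the doubled distinct cores.

If `s` and `t` are odd, the CSYDs satisfy the same conditions, and the two binomial coefficients add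
up by Pascal's rule. If one of `s` and `t` is even, let it be `s = 2 * u`. The only new CSYDs are
those that have `u` as a part. Removing `u` leaves a doubled set (`shiftedSets_two_mul`), and the
doubled sets that arise are those with `t - u ∉ M`, which means that the last increment of the half
path is `0` (`pathParts_mem_extendableSets_iff`). One of the two binomial coefficients counts these,
the other one the doubled distinct cores. (For `t = 1` only the empty partition remains.)
-/

namespace ShiftedCores

/-! ### Hook lengths in terms of the parts -/

/-- The set of parts of `μ`. -/
def parts (μ : YoungDiagram) : Finset ℕ :=
  μ.rowLens.toFinset

theorem mem_parts {μ : YoungDiagram} {x : ℕ} : x ∈ parts μ ↔ 0 < x ∧ ∃ i, μ.rowLen i = x := by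
  rw [parts, List.mem_toFinset]
  constructor
  · intro hx
    refine ⟨μ.pos_of_mem_rowLens x hx, ?_⟩
    obtain ⟨i, hi, rfl⟩ := List.mem_iff_getElem.1 hx
    exact ⟨i, YoungDiagram.get_rowLens.symm⟩
  · rintro ⟨hx, i, rfl⟩
    have hi : i < μ.rowLens.length := by
      rw [YoungDiagram.length_rowLens, ← YoungDiagram.mem_iff_lt_colLen,
        YoungDiagram.mem_iff_lt_rowLen]
      exact hx
    exact List.mem_iff_getElem.2 ⟨i, hi, YoungDiagram.get_rowLens⟩

theorem zero_notMem_parts (μ : YoungDiagram) : 0 ∉ parts μ := fun h =>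
  lt_irrefl _ (mem_parts.1 h).1

theorem parts_injOn : Set.InjOn parts {μ | IsStrict μ} := by
  intro μ hμ ν hν h
  have h' : μ.rowLens = ν.rowLens := by
    have h1 := (List.toFinset_sort (r := (· ≥ ·)) hμ).2 μ.rowLens_sorted.pairwise
    have h2 := (List.toFinset_sort (r := (· ≥ ·)) hν).2 ν.rowLens_sorted.pairwise
    rw [← h1, ← h2]
    exact congrArg (fun X : Finset ℕ => X.sort (· ≥ ·)) h
  exact YoungDiagram.equivListRowLens.injective (Subtype.ext h')

theorem exists_parts_eq {X : Finset ℕ} (hX : 0 ∉ X) : ∃ μ, IsStrict μ ∧ parts μ = X := by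
  have hpos : ∀ x ∈ X.sort (· ≥ ·), 0 < x := fun x hx =>
    Nat.pos_of_ne_zero fun h => hX (h ▸ (Finset.mem_sort _).1 hx)
  have h := YoungDiagram.rowLens_ofRowLens_eq_self (hw := (X.sortedGT_sort).sortedGE) hpos
  refine ⟨YoungDiagram.ofRowLens _ (X.sortedGT_sort).sortedGE, ?_, ?_⟩
  · rw [IsStrict, h]
    exact X.sort_nodup _
  · rw [parts, h, Finset.sort_toFinset]

theorem mem_shiftedCells {μ : YoungDiagram} {i j : ℕ} :
    (i, j) ∈ shiftedCells μ ↔ i ≤ j ∧ j < i + μ.rowLen i := by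
  simp only [shiftedCells, Finset.mem_image, Prod.exists, YoungDiagram.mem_cells,
    YoungDiagram.mem_iff_lt_rowLen, Prod.mk.injEq]
  constructor
  · rintro ⟨a, b, h, rfl, rfl⟩
    omega
  · rintro ⟨h1, h2⟩
    exact ⟨i, j - i, by omega, rfl, by omega⟩

/-- If row `i` of `D` to the right of column `j` ends before column `R`, and column `j` below row
`i` ends before row `C`, then arm and leg of `(i, j)` are read off from `R` and `C`. -/
theorem hookLength_eq {D : Finset (ℕ × ℕ)} {i j R C : ℕ}
    (hR : ∀ b, j < b → ((i, b) ∈ D ↔ b < R)) (hC : ∀ a, i < a → ((a, j) ∈ D ↔ a < C)) :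
    hookLength D i j = (R - 1 - j) + (C - 1 - i) + 1 := by
  have h1 : (D.filter fun c => c.1 = i ∧ j < c.2) = (Finset.Ioo j R).image fun b => (i, b) := by
    ext ⟨a, b⟩
    simp only [Finset.mem_filter, Finset.mem_image, Finset.mem_Ioo, Prod.mk.injEq]
    constructor
    · rintro ⟨h, rfl, hb⟩
      exact ⟨b, ⟨hb, (hR b hb).1 h⟩, rfl, rfl⟩
    · rintro ⟨b, ⟨hb, h⟩, rfl, rfl⟩
      exact ⟨(hR b hb).2 h, rfl, hb⟩
  have h2 : (D.filter fun c => c.2 = j ∧ i < c.1) = (Finset.Ioo i C).image fun a => (a, j) := by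
    ext ⟨a, b⟩
    simp only [Finset.mem_filter, Finset.mem_image, Finset.mem_Ioo, Prod.mk.injEq]
    constructor
    · rintro ⟨h, rfl, ha⟩
      exact ⟨a, ⟨ha, (hC a ha).1 h⟩, rfl, rfl⟩
    · rintro ⟨a, ⟨ha, h⟩, rfl, rfl⟩
      exact ⟨(hC a ha).2 h, rfl, ha⟩
  rw [hookLength, h1, h2, Finset.card_image_of_injective _ (fun _ _ h => (Prod.mk.inj h).2),
    Finset.card_image_of_injective _ (fun _ _ h => (Prod.mk.inj h).1), Nat.card_Ioo, Nat.card_Ioo]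
  omega

theorem card_shiftedCells_row (μ : YoungDiagram) (i : ℕ) :
    ((shiftedCells μ).filter fun c => c.1 = i).card = μ.rowLen i := by
  have : ((shiftedCells μ).filter fun c => c.1 = i)
      = (Finset.Ico i (i + μ.rowLen i)).image fun b => (i, b) := by
    ext ⟨a, b⟩
    simp only [Finset.mem_filter, Finset.mem_image, Finset.mem_Ico, Prod.mk.injEq, mem_shiftedCells]
    constructor
    · rintro ⟨h, rfl⟩
      exact ⟨b, h, rfl, rfl⟩
    · rintro ⟨b, h, rfl, rfl⟩
      exact ⟨h, rfl⟩
  rw [this, Finset.card_image_of_injective _ (fun _ _ h => (Prod.mk.inj h).2), Nat.card_Ico]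
  omega

/-- `K` is the number of rows of `S(μ)` that reach beyond column `j`. -/
def IsColumnBound (μ : YoungDiagram) (j K : ℕ) : Prop :=
  ∀ k, 0 < μ.rowLen k ∧ j < k + μ.rowLen k ↔ k < K

theorem rowLen_colLen_zero (μ : YoungDiagram) : μ.rowLen (μ.colLen 0) = 0 := by
  by_contra h
  have := (YoungDiagram.mem_iff_lt_colLen (μ := μ)).1
    (YoungDiagram.mem_iff_lt_rowLen.2 (Nat.pos_of_ne_zero h))
  omega

/-- A downward closed condition that fails somewhere cuts off an initial segment of `ℕ`. -/
theorem exists_forall_iff_lt {p : ℕ → Prop} (hp : ∀ a b, a ≤ b → p b → p a) (h : ∃ k, ¬ p k) :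
    ∃ K, ∀ k, p k ↔ k < K := by
  classical
  refine ⟨Nat.find h, fun k => ⟨fun hk => ?_, fun hk => not_not.1 (Nat.find_min h hk)⟩⟩
  by_contra hc
  exact Nat.find_spec h (hp _ _ (not_lt.1 hc) hk)

variable {μ : YoungDiagram}

theorem IsStrict.exists_isColumnBound (h : IsStrict μ) (j : ℕ) : ∃ K, IsColumnBound μ j K := by
  refine exists_forall_iff_lt (fun a b hab hb => ?_) ⟨μ.colLen 0, by simp [rowLen_colLen_zero]⟩
  have h1 := μ.rowLen_anti a b hab
  have h2 := h.add_rowLen_le hab hb.1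
  omega

/-- `h` is not a part of `μ`; the number `0` never is. -/
def IsGap (μ : YoungDiagram) (h : ℕ) : Prop :=
  ∀ k, μ.rowLen k = h → h = 0

theorem isGap_iff {h : ℕ} : IsGap μ h ↔ h ∉ parts μ := by
  rw [mem_parts, IsGap]
  constructor
  · rintro H ⟨h0, k, hk⟩
    have := H k hk
    omega
  · intro H k hk
    by_contra h0
    exact H ⟨Nat.pos_of_ne_zero h0, k, hk⟩

theorem IsColumnBound.isGap {j K : ℕ} (hK : IsColumnBound μ j K) (hj : K ≤ j + 1) :
    IsGap μ (j + 1 - K) := by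
  intro k hk
  by_contra h0
  have := hK k
  rcases lt_or_ge k K with hlt | hge
  · have := this.2 hlt
    omega
  · have : ¬ (0 < μ.rowLen k ∧ j < k + μ.rowLen k) := fun hc => absurd (this.1 hc) (by omega)
    omega

/-- Every gap `g` below the part `μ.rowLen i` comes from a box `(i, j)` of `S(μ)`. -/
theorem IsStrict.exists_column_of_isGap (h : IsStrict μ) {i g : ℕ} (hg : IsGap μ g)
    (hgi : g < μ.rowLen i) : ∃ j K, i ≤ j ∧ j < i + μ.rowLen i ∧ μ.rowLen (j + 1) = 0 ∧
      IsColumnBound μ j K ∧ K ≤ j + 1 ∧ j + 1 - K = g := by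
  obtain ⟨L, hL⟩ : ∃ L, ∀ k, g < μ.rowLen k ↔ k < L := by
    refine exists_forall_iff_lt (fun a b hab hb => ?_) ⟨μ.colLen 0, by simp [rowLen_colLen_zero]⟩
    exact hb.trans_le (μ.rowLen_anti a b hab)
  have hiL : i < L := (hL i).1 hgi
  have hlast := (hL (L - 1)).2 (by omega)
  have hlow : ∀ k, k < L → L + g ≤ k + μ.rowLen k := fun k hk => by
    have := h.add_rowLen_le (show k ≤ L - 1 by omega) (by omega)
    omega
  have hhigh : ∀ k, L ≤ k → 0 < μ.rowLen k → k + μ.rowLen k < L + g := fun k hk hpos => by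
    have h1 := h.add_rowLen_le hk hpos
    have h2 := μ.rowLen_anti L k hk
    have h3 : ¬ g < μ.rowLen L := fun hc => absurd ((hL L).1 hc) (lt_irrefl _)
    have h4 : μ.rowLen L ≠ g := fun hc => by
      have := hg L hc
      omega
    omega
  refine ⟨L + g - 1, L, by omega, ?_, ?_, fun k => ⟨?_, fun hk => ?_⟩, by omega, by omega⟩
  · have := hlow i hiL
    omega
  · by_contra hc
    have := hhigh (L + g - 1 + 1) (by omega) (by omega)
    omega
  · rintro ⟨h1, h2⟩
    by_contra hc
    have := hhigh k (by omega) h1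
    omega
  · have := hlow k hk
    have := (hL k).2 hk
    omega

theorem IsStrict.shiftedHookLength_of_pos (h : IsStrict μ) {i j : ℕ}
    (hij : i ≤ j ∧ j < i + μ.rowLen i) (hj : 0 < μ.rowLen (j + 1)) :
    shiftedHookLength μ i j = μ.rowLen i + μ.rowLen (j + 1) := by
  rw [shiftedHookLength, card_shiftedCells_row,
    hookLength_eq (R := i + μ.rowLen i) (C := j + 1)]
  · omega
  · intro b hb
    rw [mem_shiftedCells]
    omega
  · intro a ha
    rw [mem_shiftedCells]
    constructor
    · omega
    · intro haj
      have := h.add_rowLen_le haj.le hj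
      omega

theorem shiftedHookLength_of_eq_zero {i j K : ℕ}
    (hij : i ≤ j ∧ j < i + μ.rowLen i) (hj : μ.rowLen (j + 1) = 0) (hK : IsColumnBound μ j K)
    (hKj : K ≤ j + 1) : shiftedHookLength μ i j = μ.rowLen i - (j + 1 - K) := by
  have hi := (hK i).1 (by omega)
  rw [shiftedHookLength, card_shiftedCells_row, hookLength_eq (R := i + μ.rowLen i) (C := K)]
  · omega
  · intro b hb
    rw [mem_shiftedCells]
    omega
  · intro a ha
    rw [mem_shiftedCells, ← hK a]
    have := (hK a).1
    omega

theorem IsColumnBound.le {j K : ℕ} (hK : IsColumnBound μ j K) (hj : μ.rowLen (j + 1) = 0) :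
    K ≤ j + 1 := by
  by_contra hc
  have := (hK (j + 1)).2 (by omega)
  omega

/-- The divisibility condition coming from the boxes whose hook length is a part minus a gap. -/
def AvoidsGaps (s : ℕ) (μ : YoungDiagram) : Prop :=
  ∀ i g, g < μ.rowLen i → IsGap μ g → ¬ s ∣ μ.rowLen i - g

theorem IsStrict.forall_shiftedHookLength_iff (h : IsStrict μ) (s : ℕ) :
    (∀ i j, (i, j) ∈ shiftedCells μ → ¬ s ∣ shiftedHookLength μ i j) ↔
      (∀ i k, i < k → 0 < μ.rowLen k → ¬ s ∣ μ.rowLen i + μ.rowLen k) ∧ AvoidsGaps s μ := by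
  constructor
  · intro H
    constructor
    · intro i k hik hk
      obtain ⟨j, rfl⟩ : ∃ j, k = j + 1 := ⟨k - 1, by omega⟩
      have hij : i ≤ j ∧ j < i + μ.rowLen i := by
        have := h.add_rowLen_le hik.le hk
        omega
      rw [← h.shiftedHookLength_of_pos hij hk]
      exact H i j (mem_shiftedCells.2 hij)
    · intro i g hgi hg
      obtain ⟨j, K, h1, h2, h3, h4, h5, rfl⟩ := h.exists_column_of_isGap hg hgi
      rw [← shiftedHookLength_of_eq_zero ⟨h1, h2⟩ h3 h4 h5]
      exact H i j (mem_shiftedCells.2 ⟨h1, h2⟩)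
  · rintro ⟨H1, H2⟩ i j hij
    rw [mem_shiftedCells] at hij
    rcases Nat.eq_zero_or_pos (μ.rowLen (j + 1)) with h0 | h0
    · obtain ⟨K, hK⟩ := h.exists_isColumnBound j
      have hKj := hK.le h0
      have := (hK i).1 (by omega)
      rw [shiftedHookLength_of_eq_zero hij h0 hK hKj]
      exact H2 i _ (by omega) (hK.isGap hKj)
    · rw [h.shiftedHookLength_of_pos hij h0]
      exact H1 i (j + 1) (by omega) h0

theorem mem_doubled (h : IsStrict μ) {i j : ℕ} : (i, j) ∈ doubled μ h ↔
    (i < j ∧ j ≤ i + μ.rowLen i) ∨ (j ≤ i ∧ i < j + μ.rowLen j) :=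
  mem_doubledCells μ i j

theorem IsStrict.hookLength_doubled_right (h : IsStrict μ) {i j : ℕ}
    (hij : i ≤ j ∧ j < i + μ.rowLen i) (hj : 0 < μ.rowLen (j + 1)) :
    hookLength (doubledCells μ) i (j + 1) = μ.rowLen i + μ.rowLen (j + 1) := by
  rw [hookLength_eq (R := i + μ.rowLen i + 1) (C := j + 1 + μ.rowLen (j + 1))]
  · omega
  · intro b hb
    rw [mem_doubledCells]
    omega
  · intro a ha
    rw [mem_doubledCells]
    rcases lt_or_ge a (j + 1) with haj | haj
    · have := h.add_rowLen_le haj.le hj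
      omega
    · omega

theorem hookLength_doubled_right_of_eq_zero {i j K : ℕ}
    (hij : i ≤ j ∧ j < i + μ.rowLen i) (hj : μ.rowLen (j + 1) = 0) (hK : IsColumnBound μ j K)
    (hKj : K ≤ j + 1) :
    hookLength (doubledCells μ) i (j + 1) = μ.rowLen i - (j + 1 - K) := by
  have hi := (hK i).1 (by omega)
  rw [hookLength_eq (R := i + μ.rowLen i + 1) (C := K)]
  · omega
  · intro b hb
    rw [mem_doubledCells]
    omega
  · intro a ha
    rw [mem_doubledCells, ← hK a]
    have := (hK a).1
    omega

theorem IsStrict.hookLength_doubled_left (h : IsStrict μ) {i j : ℕ}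
    (hij : j ≤ i ∧ i < j + μ.rowLen j) (hi : 0 < μ.rowLen i) :
    hookLength (doubledCells μ) i j = μ.rowLen j + μ.rowLen i := by
  rw [hookLength_eq (R := i + μ.rowLen i + 1) (C := j + μ.rowLen j)]
  · omega
  · intro b hb
    rw [mem_doubledCells]
    rcases lt_or_ge i b with hib | hib
    · omega
    · have := h.add_rowLen_le hib hi
      omega
  · intro a ha
    rw [mem_doubledCells]
    omega

theorem hookLength_doubled_left_of_eq_zero {i j K : ℕ}
    (hij : j ≤ i ∧ i < j + μ.rowLen j) (hi : μ.rowLen i = 0) (hK : IsColumnBound μ i K)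
    (hKi : K ≤ i + 1) :
    hookLength (doubledCells μ) i j = μ.rowLen j - (i + 1 - K) := by
  have hj := (hK j).1 (by omega)
  have hKi' : K ≤ i := by
    by_contra hc
    have := (hK i).2 (by omega)
    omega
  rw [hookLength_eq (R := K) (C := j + μ.rowLen j)]
  · omega
  · intro b hb
    rw [mem_doubledCells, ← hK b]
    have := (hK b).1
    rcases lt_or_ge i b with hib | hib
    · have := μ.rowLen_anti i b hib.le
      omega
    · omega
  · intro a ha
    rw [mem_doubledCells]
    omega

theorem IsStrict.isCore_doubled_iff (h : IsStrict μ) (s : ℕ) :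
    IsCore s (doubled μ h) ↔
      (∀ i k, i ≤ k → 0 < μ.rowLen k → ¬ s ∣ μ.rowLen i + μ.rowLen k) ∧ AvoidsGaps s μ := by
  constructor
  · intro H
    constructor
    · intro i k hik hk
      have hik' : i ≤ k ∧ k < i + μ.rowLen i := by
        have := h.add_rowLen_le hik hk
        omega
      rw [← h.hookLength_doubled_left hik' hk]
      exact H k i ((mem_doubled h).2 (Or.inr hik'))
    · intro i g hgi hg
      obtain ⟨j, K, h1, h2, h3, h4, h5, rfl⟩ := h.exists_column_of_isGap hg hgi
      rw [← hookLength_doubled_right_of_eq_zero ⟨h1, h2⟩ h3 h4 h5]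
      exact H i (j + 1) ((mem_doubled h).2 (Or.inl (by omega)))
  · rintro ⟨H1, H2⟩ i j hij
    change ¬ s ∣ hookLength (doubledCells μ) i j
    rcases (mem_doubled h).1 hij with hij | hij
    · obtain ⟨j, rfl⟩ : ∃ j', j = j' + 1 := ⟨j - 1, by omega⟩
      have hij' : i ≤ j ∧ j < i + μ.rowLen i := by omega
      rcases Nat.eq_zero_or_pos (μ.rowLen (j + 1)) with h0 | h0
      · obtain ⟨K, hK⟩ := h.exists_isColumnBound j
        have hKj := hK.le h0
        have := (hK i).1 (by omega)
        rw [hookLength_doubled_right_of_eq_zero hij' h0 hK hKj]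
        exact H2 i _ (by omega) (hK.isGap hKj)
      · rw [h.hookLength_doubled_right hij' h0]
        exact H1 i (j + 1) (by omega) h0
    · rcases Nat.eq_zero_or_pos (μ.rowLen i) with h0 | h0
      · obtain ⟨K, hK⟩ := h.exists_isColumnBound i
        have hKi := hK.le (Nat.le_zero.1 (h0 ▸ μ.rowLen_anti i (i + 1) (Nat.le_succ i)))
        have := (hK j).1 (by omega)
        rw [hookLength_doubled_left_of_eq_zero hij h0 hK hKi]
        exact H2 j _ (by omega) (hK.isGap hKi)
      · rw [h.hookLength_doubled_left hij h0]
        exact H1 j i hij.1 h0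

/-! ### Cores as finite sets of positive integers -/

/-- `X` consists of positive integers and contains `x - s` for all its elements `x ≥ s`; in
particular it contains no multiple of `s`. -/
def IsDescending (s : ℕ) (X : Finset ℕ) : Prop :=
  0 ∉ X ∧ ∀ x ∈ X, s ≤ x → x - s ∈ X

/-- The sets of parts of the strict partitions whose doubled distinct partition is an `s`-core. -/
def IsDoubledSet (s : ℕ) (X : Finset ℕ) : Prop :=
  IsDescending s X ∧ ∀ x ∈ X, ∀ y ∈ X, ¬ s ∣ x + y

/-- The sets of parts of the `s`-core shifted Young diagrams. -/
def IsShiftedSet (s : ℕ) (X : Finset ℕ) : Prop :=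
  IsDescending s X ∧ ∀ x ∈ X, ∀ y ∈ X, x ≠ y → ¬ s ∣ x + y

theorem IsDescending.sub_mul_mem {s : ℕ} {X : Finset ℕ} (h : IsDescending s X) {x : ℕ} (hx : x ∈ X)
    (m : ℕ) (hm : s * m ≤ x) : x - s * m ∈ X := by
  induction m with
  | zero => simpa using hx
  | succ m ih =>
    rw [Nat.mul_succ] at hm ⊢
    rw [← Nat.sub_sub]
    exact h.2 _ (ih (by omega)) (by omega)

theorem IsDescending.not_dvd {s : ℕ} {X : Finset ℕ} (h : IsDescending s X) {x : ℕ} (hx : x ∈ X) :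
    ¬ s ∣ x := by
  rintro ⟨m, rfl⟩
  have := h.sub_mul_mem hx m le_rfl
  rw [Nat.sub_self] at this
  exact h.1 this

theorem avoidsGaps_iff {s : ℕ} (hs : 0 < s) : AvoidsGaps s μ ↔ IsDescending s (parts μ) := by
  constructor
  · intro H
    refine ⟨zero_notMem_parts μ, fun x hx hsx => ?_⟩
    obtain ⟨hpos, i, rfl⟩ := mem_parts.1 hx
    by_contra hc
    refine H i _ (by omega) (isGap_iff.2 hc) ?_
    rw [Nat.sub_sub_self hsx]
  · rintro H i g hgi hg ⟨m, hm⟩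
    rw [isGap_iff] at hg
    have := H.sub_mul_mem (mem_parts.2 ⟨by omega, i, rfl⟩) m (by omega)
    rw [← hm, Nat.sub_sub_self hgi.le] at this
    exact hg this

theorem isCSYD_iff {s : ℕ} (hs : 0 < s) :
    IsCSYD s μ ↔ IsStrict μ ∧ IsShiftedSet s (parts μ) := by
  refine and_congr_right fun h => ?_
  rw [h.forall_shiftedHookLength_iff, avoidsGaps_iff hs, and_comm, IsShiftedSet]
  refine and_congr_right fun _ => ⟨fun H x hx y hy hxy => ?_, fun H i k hik hk => ?_⟩
  · obtain ⟨hx0, i, rfl⟩ := mem_parts.1 hx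
    obtain ⟨hy0, k, rfl⟩ := mem_parts.1 hy
    rcases lt_trichotomy i k with hik | rfl | hik
    · exact H i k hik hy0
    · exact absurd rfl hxy
    · rw [add_comm]
      exact H k i hik hx0
  · have h1 := h.add_rowLen_le hik.le hk
    exact H _ (mem_parts.2 ⟨by omega, i, rfl⟩) _ (mem_parts.2 ⟨hk, k, rfl⟩) (by omega)

theorem IsStrict.isCore_doubled_iff_parts (h : IsStrict μ) {s : ℕ} (hs : 0 < s) :
    IsCore s (doubled μ h) ↔ IsDoubledSet s (parts μ) := by
  rw [h.isCore_doubled_iff, avoidsGaps_iff hs, and_comm, IsDoubledSet]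
  refine and_congr_right fun _ => ⟨fun H x hx y hy => ?_, fun H i k hik hk => ?_⟩
  · obtain ⟨hx0, i, rfl⟩ := mem_parts.1 hx
    obtain ⟨hy0, k, rfl⟩ := mem_parts.1 hy
    rcases le_total i k with hik | hik
    · exact H i k hik hy0
    · rw [add_comm]
      exact H k i hik hx0
  · have h1 := h.add_rowLen_le hik hk
    exact H _ (mem_parts.2 ⟨by omega, i, rfl⟩) _ (mem_parts.2 ⟨hk, k, rfl⟩)

theorem doubled_injective {μ ν : YoungDiagram} (hμ : IsStrict μ) (hν : IsStrict ν)
    (h : doubled μ hμ = doubled ν hν) : μ = ν := by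
  have key : ∀ i j, i < j → (j ≤ i + μ.rowLen i ↔ j ≤ i + ν.rowLen i) := fun i j hij => by
    have h1 := mem_doubled hμ (i := i) (j := j)
    have h2 := mem_doubled hν (i := i) (j := j)
    rw [h] at h1
    have h3 := h1.symm.trans h2
    omega
  apply YoungDiagram.ext
  ext ⟨i, j⟩
  rw [YoungDiagram.mem_cells, YoungDiagram.mem_cells, YoungDiagram.mem_iff_lt_rowLen,
    YoungDiagram.mem_iff_lt_rowLen]
  have := key i (i + j + 1) (by omega)
  omega

/-- The sets of parts of the strict partitions in question for `s` and `t` simultaneously. -/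
def doubledSets (s t : ℕ) : Set (Finset ℕ) :=
  {X | IsDoubledSet s X ∧ IsDoubledSet t X}

/-- The sets of parts of the `(s, t)`-CSYDs. -/
def shiftedSets (s t : ℕ) : Set (Finset ℕ) :=
  {X | IsShiftedSet s X ∧ IsShiftedSet t X}

theorem bijOn_parts_CS {s t : ℕ} (hs : 0 < s) (ht : 0 < t) :
    Set.BijOn parts (CS s t) (shiftedSets s t) := by
  refine ⟨fun μ hμ => ⟨((isCSYD_iff hs).1 hμ.1).2, ((isCSYD_iff ht).1 hμ.2).2⟩,
    parts_injOn.mono fun μ hμ => hμ.1.1, fun X hX => ?_⟩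
  obtain ⟨μ, hμ, rfl⟩ := exists_parts_eq hX.1.1.1
  exact ⟨μ, ⟨(isCSYD_iff hs).2 ⟨hμ, hX.1⟩, (isCSYD_iff ht).2 ⟨hμ, hX.2⟩⟩, rfl⟩

theorem exists_bijOn_DD {s t : ℕ} (hs : 0 < s) (ht : 0 < t) :
    ∃ f, Set.BijOn f (doubledSets s t) (DD s t) := by
  have hex : ∀ X : Finset ℕ, ∃ ν, 0 ∉ X → ∃ μ, ∃ h : IsStrict μ, parts μ = X ∧ ν = doubled μ h := by
    intro X
    by_cases hX : 0 ∈ X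
    · exact ⟨⊥, fun h => absurd hX h⟩
    · obtain ⟨μ, h, hμ⟩ := exists_parts_eq hX
      exact ⟨_, fun _ => ⟨μ, h, hμ, rfl⟩⟩
  choose f hf using hex
  refine ⟨f, fun X hX => ?_, fun X hX Y hY hXY => ?_, ?_⟩
  · obtain ⟨μ, h, rfl, he⟩ := hf X hX.1.1.1
    rw [he]
    exact ⟨⟨μ, h, rfl⟩, (h.isCore_doubled_iff_parts hs).2 hX.1,
      (h.isCore_doubled_iff_parts ht).2 hX.2⟩
  · obtain ⟨μ, h, rfl, he⟩ := hf X hX.1.1.1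
    obtain ⟨ν, h', rfl, he'⟩ := hf Y hY.1.1.1
    rw [doubled_injective h h' (by rw [← he, ← he', hXY])]
  · rintro _ ⟨⟨μ, h, rfl⟩, h1, h2⟩
    refine ⟨parts μ, ⟨(h.isCore_doubled_iff_parts hs).1 h1, (h.isCore_doubled_iff_parts ht).1 h2⟩,
      ?_⟩
    obtain ⟨ν, h', he, he'⟩ := hf (parts μ) (zero_notMem_parts μ)
    obtain rfl := parts_injOn h' h he
    exact he'

/-! ### Symmetric subsets of the integers -/

/-- The set of integers containing `0` and `X`, and containing exactly one of `z` and `-z` for every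
`z ≠ 0`. -/
def symmetrize (X : Finset ℕ) : Set ℤ :=
  {z | z = 0 ∨ (0 < z ∧ z.toNat ∈ X) ∨ (z < 0 ∧ (-z).toNat ∉ X)}

theorem zero_mem_symmetrize (X : Finset ℕ) : (0 : ℤ) ∈ symmetrize X := Or.inl rfl

theorem natCast_mem_symmetrize {X : Finset ℕ} {x : ℕ} (hx : 0 < x) :
    (x : ℤ) ∈ symmetrize X ↔ x ∈ X := by
  have : ¬ (x : ℤ) < 0 := by omega
  simp [symmetrize, hx, hx.ne', this]

theorem neg_mem_symmetrize {X : Finset ℕ} {z : ℤ} (hz : z ≠ 0) :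
    -z ∈ symmetrize X ↔ z ∉ symmetrize X := by
  rcases lt_or_gt_of_ne hz with h | h
  · have h1 : ¬ 0 < z := by omega
    simp [symmetrize, hz, h, h1]
  · have h1 : ¬ z < 0 := by omega
    simp [symmetrize, hz, h, h1]

theorem neg_natCast_mem_symmetrize {X : Finset ℕ} {x : ℕ} (hx : 0 < x) :
    -(x : ℤ) ∈ symmetrize X ↔ x ∉ X := by
  rw [neg_mem_symmetrize (by omega), natCast_mem_symmetrize hx]

theorem sub_mul_mem {M : Set ℤ} {s : ℕ} (hM : ∀ z ∈ M, z - s ∈ M) {z : ℤ} (hz : z ∈ M) (m : ℕ) :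
    z - s * m ∈ M := by
  induction m with
  | zero => simpa using hz
  | succ m ih =>
    have := hM _ ih
    rwa [show z - s * ((m + 1 : ℕ) : ℤ) = z - s * m - s by push_cast; ring]

/-- The core condition on a set of parts says that the symmetrized set is closed under
subtracting `s`. -/
theorem isDoubledSet_iff {s : ℕ} (hs : 0 < s) {X : Finset ℕ} :
    IsDoubledSet s X ↔ 0 ∉ X ∧ ∀ z ∈ symmetrize X, z - s ∈ symmetrize X := by
  constructor
  · rintro ⟨⟨h0, h1⟩, h2⟩
    have hdvd : ∀ {x}, x ∈ X → ¬ s ∣ x := fun hx => IsDescending.not_dvd ⟨h0, h1⟩ hx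
    refine ⟨h0, fun z hz => ?_⟩
    rcases lt_trichotomy z 0 with hneg | rfl | hpos
    · obtain ⟨x, rfl⟩ : ∃ x : ℕ, z = -(x : ℤ) := ⟨z.natAbs, by omega⟩
      rw [neg_natCast_mem_symmetrize (by omega)] at hz
      rw [show -(x : ℤ) - s = -((x + s : ℕ) : ℤ) by push_cast; ring,
        neg_natCast_mem_symmetrize (by omega)]
      intro hc
      have := h1 _ hc (by omega)
      rw [Nat.add_sub_cancel] at this
      exact hz this
    · rw [zero_sub, neg_natCast_mem_symmetrize hs]
      exact fun hc => hdvd hc dvd_rfl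
    · obtain ⟨x, rfl⟩ : ∃ x : ℕ, z = x := ⟨z.toNat, by omega⟩
      rw [natCast_mem_symmetrize (by omega)] at hz
      rcases lt_trichotomy x s with hxs | rfl | hxs
      · rw [show (x : ℤ) - s = -((s - x : ℕ) : ℤ) by omega, neg_natCast_mem_symmetrize (by omega)]
        intro hc
        refine h2 _ hz _ hc ?_
        rw [Nat.add_sub_cancel' hxs.le]
      · exact absurd dvd_rfl (hdvd hz)
      · rw [show (x : ℤ) - s = ((x - s : ℕ) : ℤ) by omega, natCast_mem_symmetrize (by omega)]
        exact h1 x hz hxs.le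
  · rintro ⟨h0, hM⟩
    have hpos : ∀ x ∈ X, 0 < x := fun x hx => Nat.pos_of_ne_zero fun h => h0 (h ▸ hx)
    have hsX : s ∉ X := by
      rw [← neg_natCast_mem_symmetrize hs, ← zero_sub]
      exact hM 0 (zero_mem_symmetrize X)
    refine ⟨⟨h0, fun x hx hsx => ?_⟩, fun x hx y hy => ?_⟩
    · have hlt : s < x := lt_of_le_of_ne hsx fun h => hsX (h ▸ hx)
      have := hM _ ((natCast_mem_symmetrize (hpos x hx)).2 hx)
      rwa [show (x : ℤ) - s = ((x - s : ℕ) : ℤ) by omega,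
        natCast_mem_symmetrize (by omega)] at this
    · rintro ⟨m, hm⟩
      have := sub_mul_mem hM ((natCast_mem_symmetrize (hpos x hx)).2 hx) m
      rw [show (x : ℤ) - s * m = -(y : ℤ) by
        have : (x : ℤ) + y = s * m := by exact_mod_cast hm
        linarith, neg_natCast_mem_symmetrize (hpos y hy)] at this
      exact this hy

/-! ### Periodic lattice paths -/

/-- The heights `c 0, …, c (s + t)` of a lattice path with `s + t` increments, each `0` or `1`, from
height `0` to height `s`, whose part strictly between its end points is symmetric under a half turn.
The values of `c` beyond `s + t` are arbitrary. -/
structure IsPath (s t : ℕ) (c : ℕ → ℤ) : Prop where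
  zero : c 0 = 0
  top : c (s + t) = s
  le_succ : ∀ j < s + t, c j ≤ c (j + 1)
  succ_le : ∀ j < s + t, c (j + 1) ≤ c j + 1
  symm : ∀ j, 0 < j → j < s + t → c j + c (s + t - j) = s + 1

/-- The integers cut out by the path: those `j * s - (s + t) * k` with `c j ≤ k`. -/
def pathSet (s t : ℕ) (c : ℕ → ℤ) : Set ℤ :=
  {z | ∃ j : ℕ, j < s + t ∧ ∃ k : ℤ, c j ≤ k ∧ z = j * s - (s + t : ℕ) * k}

variable {s t : ℕ} {c : ℕ → ℤ}

theorem exists_eq_mul_sub_mul (hs : 0 < s) (hst : Nat.Coprime s t) (z : ℤ) :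
    ∃ j : ℕ, j < s + t ∧ ∃ k : ℤ, z = j * s - (s + t : ℕ) * k := by
  have hco : IsCoprime (s : ℤ) ((s + t : ℕ) : ℤ) :=
    Nat.isCoprime_iff_coprime.2 (by simpa using hst)
  obtain ⟨a, b, hab⟩ := hco
  have hn : (0 : ℤ) < (s + t : ℕ) := by omega
  have h1 := Int.emod_nonneg (z * a) hn.ne'
  have h2 := Int.emod_lt_of_pos (z * a) hn
  have h3 := Int.emod_add_mul_ediv (z * a) (s + t : ℕ)
  refine ⟨(z * a % (s + t : ℕ)).toNat, by omega,
    -(z * a / (s + t : ℕ) * s + z * b), ?_⟩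
  rw [Int.toNat_of_nonneg h1]
  linear_combination (-z) * hab - s * h3

theorem mul_sub_mul_injective (hst : Nat.Coprime s t) {i j : ℕ} (hi : i < s + t) (hj : j < s + t)
    {k l : ℤ} (h : (i : ℤ) * s - (s + t : ℕ) * k = j * s - (s + t : ℕ) * l) : i = j ∧ k = l := by
  have hco : IsCoprime ((s + t : ℕ) : ℤ) (s : ℤ) :=
    (Nat.isCoprime_iff_coprime.2 (by simpa using hst)).symm
  have hd : ((s + t : ℕ) : ℤ) ∣ (i : ℤ) - j := by
    refine hco.dvd_of_dvd_mul_right ⟨k - l, ?_⟩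
    linear_combination h
  have hij : i = j := by
    have := Int.eq_zero_of_abs_lt_dvd hd (by rw [abs_lt]; omega)
    omega
  subst hij
  refine ⟨rfl, ?_⟩
  have hn : ((s + t : ℕ) : ℤ) ≠ 0 := by omega
  exact mul_left_cancel₀ hn (by linarith)

/-- The index `j = s + t`, excluded in `pathSet`, is allowed here: it gives the same integers as
`j = 0`, and the heights `c (s + t) = s` and `c 0 = 0` fit. -/
theorem IsPath.mem_pathSet_iff (hc : IsPath s t c) (hs : 0 < s) (hst : Nat.Coprime s t) {j : ℕ}
    (hj : j ≤ s + t) (k : ℤ) : (j : ℤ) * s - (s + t : ℕ) * k ∈ pathSet s t c ↔ c j ≤ k := by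
  rcases hj.lt_or_eq with hj | rfl
  · constructor
    · rintro ⟨i, hi, l, hl, h⟩
      obtain ⟨rfl, rfl⟩ := mul_sub_mul_injective hst hj hi h
      exact hl
    · exact fun h => ⟨j, hj, k, h, rfl⟩
  · rw [hc.top]
    constructor
    · rintro ⟨i, hi, l, hl, h⟩
      obtain ⟨rfl, h'⟩ := mul_sub_mul_injective hst (show 0 < s + t by omega) hi
        (k := k - s) (l := l) (by rw [← h]; push_cast; ring)
      rw [hc.zero] at hl
      omega
    · exact fun h => ⟨0, by omega, k - s, by rw [hc.zero]; omega, by push_cast; ring⟩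

theorem IsPath.sub_left_mem (hc : IsPath s t c) (hs : 0 < s) (hst : Nat.Coprime s t) {z : ℤ}
    (hz : z ∈ pathSet s t c) : z - s ∈ pathSet s t c := by
  obtain ⟨j, hj, k, hk, rfl⟩ := hz
  rcases j with _ | j
  · rw [show ((0 : ℕ) : ℤ) * s - (s + t : ℕ) * k - s
      = ((s + t - 1 : ℕ) : ℤ) * s - (s + t : ℕ) * (k + s) by
        push_cast [show 1 ≤ s + t by omega]; ring, hc.mem_pathSet_iff hs hst (by omega)]
    have h1 := hc.le_succ (s + t - 1) (by omega)
    rw [Nat.sub_add_cancel (by omega), hc.top] at h1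
    rw [hc.zero] at hk
    omega
  · rw [show ((j + 1 : ℕ) : ℤ) * s - (s + t : ℕ) * k - s = (j : ℤ) * s - (s + t : ℕ) * k by
      push_cast; ring, hc.mem_pathSet_iff hs hst (by omega)]
    exact (hc.le_succ j (by omega)).trans hk

theorem IsPath.sub_right_mem (hc : IsPath s t c) (hs : 0 < s) (hst : Nat.Coprime s t) {z : ℤ}
    (hz : z ∈ pathSet s t c) : z - t ∈ pathSet s t c := by
  obtain ⟨j, hj, k, hk, rfl⟩ := hz
  rw [show (j : ℤ) * s - (s + t : ℕ) * k - t = ((j + 1 : ℕ) : ℤ) * s - (s + t : ℕ) * (k + 1) by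
    push_cast; ring, hc.mem_pathSet_iff hs hst (by omega)]
  have := hc.succ_le j hj
  omega

theorem IsPath.neg_mem_pathSet (hc : IsPath s t c) (hs : 0 < s) (hst : Nat.Coprime s t) {z : ℤ}
    (hz : z ≠ 0) : -z ∈ pathSet s t c ↔ z ∉ pathSet s t c := by
  obtain ⟨j, hj, k, rfl⟩ := exists_eq_mul_sub_mul hs hst z
  rw [hc.mem_pathSet_iff hs hst hj.le]
  rcases Nat.eq_zero_or_pos j with rfl | hj0
  · have hk : k ≠ 0 := by
      rintro rfl
      simp at hz
    rw [show -(((0 : ℕ) : ℤ) * s - (s + t : ℕ) * k) = ((0 : ℕ) : ℤ) * s - (s + t : ℕ) * (-k) by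
      ring, hc.mem_pathSet_iff hs hst (by omega), hc.zero]
    omega
  · rw [show -((j : ℤ) * s - (s + t : ℕ) * k)
      = ((s + t - j : ℕ) : ℤ) * s - (s + t : ℕ) * (s - k) by
        push_cast [hj.le]; ring, hc.mem_pathSet_iff hs hst (by omega)]
    have := hc.symm j hj0 hj
    omega

theorem IsPath.zero_mem_pathSet (hc : IsPath s t c) (hs : 0 < s) : (0 : ℤ) ∈ pathSet s t c :=
  ⟨0, by omega, 0, by rw [hc.zero], by simp⟩

theorem IsPath.nonneg (hc : IsPath s t c) {j : ℕ} (hj : j ≤ s + t) : 0 ≤ c j := by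
  induction j with
  | zero => exact hc.zero.ge
  | succ j ih => exact (ih (by omega)).trans (hc.le_succ j (by omega))

open Classical in
/-- The positive elements of `pathSet s t c`, all of which are less than `(s + t) * s` when `c` is
a path. -/
noncomputable def pathParts (s t : ℕ) (c : ℕ → ℤ) : Finset ℕ :=
  (Finset.Ioo 0 ((s + t) * s)).filter fun x => (x : ℤ) ∈ pathSet s t c

theorem IsPath.mem_pathParts (hc : IsPath s t c) (hs : 0 < s) {x : ℕ} (hx : 0 < x) :
    x ∈ pathParts s t c ↔ (x : ℤ) ∈ pathSet s t c := by
  classical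
  rw [pathParts, Finset.mem_filter, Finset.mem_Ioo, and_iff_right_iff_imp]
  rintro ⟨j, hj, k, hk, h⟩
  refine ⟨hx, ?_⟩
  have h0 : 0 ≤ k := (hc.nonneg hj.le).trans hk
  have h1 : (0 : ℤ) ≤ (s + t : ℕ) * k := by positivity
  have h2 : (j : ℤ) * s < (s + t : ℕ) * s := by
    have : (j : ℤ) < (s + t : ℕ) := by exact_mod_cast hj
    have : (0 : ℤ) < s := by exact_mod_cast hs
    nlinarith
  have h3 : (x : ℤ) < (s + t : ℕ) * s := by linarith
  exact_mod_cast h3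

theorem IsPath.symmetrize_pathParts (hc : IsPath s t c) (hs : 0 < s) (hst : Nat.Coprime s t) :
    symmetrize (pathParts s t c) = pathSet s t c := by
  ext z
  rcases lt_trichotomy z 0 with h | rfl | h
  · obtain ⟨x, rfl⟩ : ∃ x : ℕ, z = -(x : ℤ) := ⟨z.natAbs, by omega⟩
    rw [neg_natCast_mem_symmetrize (by omega), hc.mem_pathParts hs (by omega),
      hc.neg_mem_pathSet hs hst (by omega)]
  · exact iff_of_true (zero_mem_symmetrize _) (hc.zero_mem_pathSet hs)
  · obtain ⟨x, rfl⟩ : ∃ x : ℕ, z = x := ⟨z.toNat, by omega⟩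
    rw [natCast_mem_symmetrize (by omega), hc.mem_pathParts hs (by omega)]

theorem IsPath.pathParts_mem (hc : IsPath s t c) (hs : 0 < s) (ht : 0 < t)
    (hst : Nat.Coprime s t) : pathParts s t c ∈ doubledSets s t := by
  have h0 : 0 ∉ pathParts s t c := by simp [pathParts]
  have h := hc.symmetrize_pathParts hs hst
  exact ⟨(isDoubledSet_iff hs).2 ⟨h0, h ▸ fun z hz => hc.sub_left_mem hs hst hz⟩,
    (isDoubledSet_iff ht).2 ⟨h0, h ▸ fun z hz => hc.sub_right_mem hs hst hz⟩⟩

theorem symmetrize_injOn : Set.InjOn symmetrize {X | 0 ∉ X} := by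
  intro X hX Y hY h
  ext x
  rcases Nat.eq_zero_or_pos x with rfl | hx
  · exact iff_of_false hX hY
  · rw [← natCast_mem_symmetrize hx, h, natCast_mem_symmetrize hx]

/-- An upward closed condition on integers holding somewhere and failing
somewhere has a least solution. -/
theorem exists_forall_iff_le {p : ℤ → Prop} (hp : ∀ k, p k → p (k + 1)) {a b : ℤ} (ha : ¬ p a)
    (hb : p b) : ∃ m, ∀ k, p k ↔ m ≤ k := by
  have hup : ∀ k l, k ≤ l → p k → p l := fun k l hkl hk => 
    Int.leInduction hk (fun m _ => hp m) l hkl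
  obtain ⟨m, hm, hmin⟩ := Int.exists_least_of_bdd (P := p)
    ⟨a, fun z hz => not_lt.1 fun h => ha (hup z a h.le hz)⟩ ⟨b, hb⟩
  exact ⟨m, fun k => ⟨hmin k, fun h => hup m k h hm⟩⟩

/-- Every set of parts arises from a path: `c j` is the least `k` such that
`j * s - (s + t) * k` lies in the symmetrized set. -/
theorem exists_isPath (hs : 0 < s) (ht : 0 < t) (hst : Nat.Coprime s t) {X : Finset ℕ}
    (hX : X ∈ doubledSets s t) : ∃ c, IsPath s t c ∧ pathParts s t c = X := by
  obtain ⟨h0, hMs⟩ := (isDoubledSet_iff hs).1 hX.1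
  obtain ⟨-, hMt⟩ := (isDoubledSet_iff ht).1 hX.2
  have hex : ∀ j : ℕ, ∃ m : ℤ, ∀ k : ℤ,
      (j : ℤ) * s - (s + t : ℕ) * k ∈ symmetrize X ↔ m ≤ k := by
    intro j
    refine exists_forall_iff_le (a := -1) (b := j) (fun k hk => ?_) ?_ ?_
    · have := hMt _ (hMs _ hk)
      rwa [show (j : ℤ) * s - (s + t : ℕ) * (k + 1) = j * s - (s + t : ℕ) * k - s - t by
        push_cast; ring]
    · rw [← neg_mem_symmetrize (by push_cast; nlinarith)]
      have := hMt _ (sub_mul_mem hMs (zero_mem_symmetrize X) (j + 1))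
      rwa [show -((j : ℤ) * s - (s + t : ℕ) * (-1)) = 0 - s * ((j + 1 : ℕ) : ℤ) - t by
        push_cast; ring]
    · have := sub_mul_mem hMt (zero_mem_symmetrize X) j
      rwa [show (j : ℤ) * s - (s + t : ℕ) * j = 0 - t * j by push_cast; ring]
  choose c hc using hex
  have hzero : c 0 = 0 := by
    have h1 := (hc 0 0).1 (by simpa using zero_mem_symmetrize X)
    have h2 : ¬ c 0 ≤ -1 := by
      rw [← hc, ← neg_mem_symmetrize (by push_cast; nlinarith)]
      have := hMt _ (hMs _ (zero_mem_symmetrize X))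
      rwa [show -(((0 : ℕ) : ℤ) * s - (s + t : ℕ) * (-1)) = 0 - s - t by push_cast; ring]
    omega
  have hpath : IsPath s t c := by
    refine ⟨hzero, ?_, fun j _ => ?_, fun j _ => ?_, fun j hj0 hj => ?_⟩
    · have key : ∀ k : ℤ, c (s + t) ≤ k ↔ c 0 ≤ k - s := fun k => by
        rw [← hc, ← hc, show ((s + t : ℕ) : ℤ) * s - (s + t : ℕ) * k
          = ((0 : ℕ) : ℤ) * s - (s + t : ℕ) * (k - s) by push_cast; ring]
      have h1 := (key (c (s + t))).1 le_rfl
      have h2 := (key s).2 (by rw [hzero]; omega)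
      omega
    · rw [← hc]
      have := hMs _ ((hc (j + 1) _).2 le_rfl)
      rwa [show ((j + 1 : ℕ) : ℤ) * s - (s + t : ℕ) * c (j + 1) - s
        = j * s - (s + t : ℕ) * c (j + 1) by push_cast; ring] at this
    · rw [← hc]
      have := hMt _ ((hc j _).2 le_rfl)
      rwa [show (j : ℤ) * s - (s + t : ℕ) * c j - t
        = ((j + 1 : ℕ) : ℤ) * s - (s + t : ℕ) * (c j + 1) by push_cast; ring] at this
    · have key : ∀ k : ℤ, c (s + t - j) ≤ s - k ↔ ¬ c j ≤ k := fun k => by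
        rw [← hc, ← hc, show ((s + t - j : ℕ) : ℤ) * s - (s + t : ℕ) * (s - k)
          = -(j * s - (s + t : ℕ) * k) by push_cast [hj.le]; ring, neg_mem_symmetrize]
        intro hz
        have := mul_sub_mul_injective hst hj (show 0 < s + t by omega) (k := k) (l := 0)
          (by rw [hz]; simp)
        omega
      have h1 := key (c j)
      have h2 := key (c j - 1)
      omega
  refine ⟨c, hpath, symmetrize_injOn (hpath.pathParts_mem hs ht hst).1.1.1 h0 ?_⟩
  rw [hpath.symmetrize_pathParts hs hst]
  ext z
  obtain ⟨j, hj, k, rfl⟩ := exists_eq_mul_sub_mul hs hst z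
  rw [hpath.mem_pathSet_iff hs hst hj.le, hc]

/-! ### Counting paths -/

/-- The path whose increments from `1` to `(s + t) / 2` are given by membership of
`0, 1, …, (s + t) / 2 - 2` in `T`, continued by symmetry. -/
def pathOf (s t : ℕ) (T : Finset ℕ) (j : ℕ) : ℤ :=
  if j = 0 then 0
  else if j ≤ (s + t) / 2 then 1 + (T.filter (· < j - 1)).card
  else if j < s + t then s - (T.filter (· < s + t - j - 1)).card
  else s

/-- The increments of paths on the first half of a period. -/
def stepSets (s t : ℕ) : Finset (Finset ℕ) :=
  Finset.powersetCard ((s - 1) / 2) (Finset.range ((s + t) / 2 - 1))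

theorem card_filter_lt_succ (T : Finset ℕ) (i : ℕ) :
    (T.filter (· < i + 1)).card = (T.filter (· < i)).card + if i ∈ T then 1 else 0 := by
  have h : T.filter (· < i + 1) = T.filter (· < i) ∪ T.filter (· = i) := by
    ext x
    simp only [Finset.mem_filter, Finset.mem_union]
    rw [← and_or_left]
    refine and_congr_right fun _ => by omega
  rw [h, Finset.card_union_of_disjoint, Finset.filter_eq']
  · split_ifs <;> simp
  · rw [Finset.disjoint_filter]
    omega

theorem filter_lt_eq_self {T : Finset ℕ} {m : ℕ} (hT : T ⊆ Finset.range m) :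
    T.filter (· < m) = T :=
  Finset.filter_true_of_mem fun _ hx => Finset.mem_range.1 (hT hx)

theorem pathOf_succ {T : Finset ℕ} {i : ℕ} (hi : i + 1 ≤ (s + t) / 2) :
    pathOf s t T (i + 1) = 1 + (T.filter (· < i)).card := by
  rw [pathOf, if_neg (by omega), if_pos hi, Nat.add_sub_cancel]

theorem pathOf_sub {T : Finset ℕ} {j : ℕ} (h0 : 0 < j) (hj : j < s + t - (s + t) / 2) :
    pathOf s t T (s + t - j) = s - (T.filter (· < j - 1)).card := by
  rw [pathOf, if_neg (by omega), if_neg (by omega), if_pos (by omega),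
    Nat.sub_sub_self (by omega)]

theorem half_add_sub_one (hs : 0 < s) (ht : 0 < t) (hst : Nat.Coprime s t) :
    (s + t) / 2 - 1 = (s - 1) / 2 + (t - 1) / 2 := by
  have : ¬ (2 ∣ s ∧ 2 ∣ t) := fun h => Nat.not_coprime_of_dvd_of_dvd one_lt_two h.1 h.2 hst
  omega

theorem isPath_pathOf (hs : 0 < s) (ht : 0 < t) (hst : Nat.Coprime s t) {T : Finset ℕ}
    (hT : T ∈ stepSets s t) : IsPath s t (pathOf s t T) := by
  obtain ⟨hsub, hcard⟩ := Finset.mem_powersetCard.1 hT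
  have hhalf := half_add_sub_one hs ht hst
  have hstep : ∀ i, (T.filter (· < i)).card ≤ (T.filter (· < i + 1)).card ∧
      (T.filter (· < i + 1)).card ≤ (T.filter (· < i)).card + 1 := fun i => by
    rw [card_filter_lt_succ]
    split_ifs <;> omega
  have hfull : (T.filter (· < (s + t) / 2 - 1)).card = (s - 1) / 2 := by
    rw [filter_lt_eq_self hsub, hcard]
  have hone : (T.filter (· < 0)).card = 0 := by simp
  have hstep' : ∀ j < s + t, pathOf s t T j ≤ pathOf s t T (j + 1) ∧
      pathOf s t T (j + 1) ≤ pathOf s t T j + 1 := by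
    intro j hj
    rcases Nat.eq_zero_or_pos j with rfl | hj0
    · rw [pathOf_succ (by omega), hone, pathOf, if_pos rfl]
      omega
    obtain ⟨i, rfl⟩ : ∃ i, j = i + 1 := ⟨j - 1, by omega⟩
    rcases lt_trichotomy (i + 1) ((s + t) / 2) with h | h | h
    · rw [pathOf_succ (by omega), pathOf_succ (by omega)]
      have := hstep i
      omega
    · rw [pathOf_succ h.le, show i = (s + t) / 2 - 1 by omega, hfull]
      rcases Nat.eq_zero_or_pos (s + t - ((s + t) / 2 - 1 + 1 + 1)) with h0 | h0
      · rw [pathOf, if_neg (by omega), if_neg (by omega), if_neg (by omega)]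
        omega
      · rw [show (s + t) / 2 - 1 + 1 + 1 = s + t - (s + t - ((s + t) / 2 - 1 + 1 + 1)) by omega,
          pathOf_sub h0 (by omega)]
        rcases Nat.even_or_odd' (s + t) with ⟨m, hm | hm⟩
        · have := hstep ((s + t) / 2 - 2)
          rw [show (s + t) / 2 - 2 + 1 = (s + t) / 2 - 1 by omega, hfull] at this
          rw [show s + t - ((s + t) / 2 - 1 + 1 + 1) - 1 = (s + t) / 2 - 2 by omega]
          omega
        · rw [show s + t - ((s + t) / 2 - 1 + 1 + 1) - 1 = (s + t) / 2 - 1 by omega, hfull]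
          omega
    · rw [show i + 1 = s + t - (s + t - (i + 1)) by omega, pathOf_sub (by omega) (by omega)]
      rcases Nat.eq_zero_or_pos (s + t - (i + 2)) with h0 | h0
      · rw [pathOf, if_neg (by omega), if_neg (by omega), if_neg (by omega),
          show s + t - (i + 1) - 1 = 0 by omega, hone]
        omega
      · rw [show s + t - (s + t - (i + 1)) + 1 = s + t - (s + t - (i + 2)) by omega,
          pathOf_sub (by omega) (by omega)]
        have := hstep (s + t - (i + 2) - 1)
        rw [show s + t - (i + 2) - 1 + 1 = s + t - (i + 1) - 1 by omega] at this
        omega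
  refine ⟨by rw [pathOf, if_pos rfl], ?_, fun j hj => (hstep' j hj).1, fun j hj => (hstep' j hj).2,
    ?_⟩
  · rw [pathOf, if_neg (by omega), if_neg (by omega), if_neg (by omega)]
  · have hsymm : ∀ j, 0 < j → j < s + t - (s + t) / 2 →
        pathOf s t T j + pathOf s t T (s + t - j) = s + 1 := fun j h0 h1 => by
      rw [pathOf_sub h0 h1]
      obtain ⟨i, rfl⟩ : ∃ i, j = i + 1 := ⟨j - 1, by omega⟩
      rw [pathOf_succ (by omega), Nat.add_sub_cancel]
      ring
    intro j h0 h1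
    rcases lt_or_ge j (s + t - (s + t) / 2) with h | h
    · exact hsymm j h0 h
    rcases lt_or_ge (s + t - j) (s + t - (s + t) / 2) with h' | h'
    · have := hsymm (s + t - j) (by omega) h'
      rw [Nat.sub_sub_self h1.le] at this
      rw [← this, add_comm]
    · have hj : j = (s + t) / 2 - 1 + 1 := by omega
      have hj' : s + t - j = (s + t) / 2 - 1 + 1 := by omega
      rw [hj', hj, pathOf_succ (by omega), hfull]
      omega

theorem IsPath.apply_one (hc : IsPath s t c) (hs : 0 < s) (ht : 0 < t) : c 1 = 1 := by
  have h1 := hc.symm 1 one_pos (by omega)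
  have h2 := hc.le_succ (s + t - 1) (by omega)
  rw [Nat.sub_add_cancel (by omega), hc.top] at h2
  have h3 := hc.succ_le 0 (by omega)
  rw [hc.zero] at h3
  simp only [zero_add] at h3
  omega

/-- Every path is determined by its increments on the first half of a period, and the symmetry fixes
the number of these increments that are equal to `1`. -/
theorem IsPath.exists_eq_pathOf (hc : IsPath s t c) (hs : 0 < s) (ht : 0 < t)
    (hst : Nat.Coprime s t) :
    ∃ T ∈ stepSets s t, ∀ j < s + t, c j = pathOf s t T j := by
  set T := (Finset.range ((s + t) / 2 - 1)).filter fun i => c (i + 2) = c (i + 1) + 1 with hTdef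
  have hhalf : ∀ i, i + 1 ≤ (s + t) / 2 → c (i + 1) = 1 + (T.filter (· < i)).card := by
    intro i
    induction i with
    | zero => simp [hc.apply_one hs ht]
    | succ i ih =>
      intro hi
      have h1 := ih (by omega)
      have h2 := hc.le_succ (i + 1) (by omega)
      have h3 := hc.succ_le (i + 1) (by omega)
      have h4 : i ∈ T ↔ c (i + 2) = c (i + 1) + 1 := by
        rw [hTdef, Finset.mem_filter, Finset.mem_range, and_iff_right (by omega)]
      rw [card_filter_lt_succ]
      rw [show i + 1 + 1 = i + 2 from rfl] at *
      split_ifs with h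
      · have := h4.1 h
        push_cast
        omega
      · have : ¬ c (i + 2) = c (i + 1) + 1 := fun hc => h (h4.2 hc)
        push_cast
        omega
  have hsub : T ⊆ Finset.range ((s + t) / 2 - 1) := Finset.filter_subset _ _
  have hmid := hhalf ((s + t) / 2 - 1) (by omega)
  rw [filter_lt_eq_self hsub, Nat.sub_add_cancel (by omega)] at hmid
  have hsymm := hc.symm ((s + t) / 2) (by omega) (by omega)
  have hcard : T.card = (s - 1) / 2 := by
    rcases Nat.even_or_odd' (s + t) with ⟨m, hm | hm⟩
    · rw [show s + t - (s + t) / 2 = (s + t) / 2 by omega] at hsymm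
      omega
    · have h1 := hc.le_succ ((s + t) / 2) (by omega)
      have h2 := hc.succ_le ((s + t) / 2) (by omega)
      rw [show s + t - (s + t) / 2 = (s + t) / 2 + 1 by omega] at hsymm
      omega
  have hT : T ∈ stepSets s t := Finset.mem_powersetCard.2 ⟨hsub, hcard⟩
  have hp := isPath_pathOf hs ht hst hT
  have heq : ∀ j, 0 < j → j ≤ (s + t) / 2 → c j = pathOf s t T j := fun j h0 hj => by
    obtain ⟨i, rfl⟩ : ∃ i, j = i + 1 := ⟨j - 1, by omega⟩
    rw [pathOf_succ hj, hhalf i hj]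
  refine ⟨T, hT, fun j hj => ?_⟩
  rcases Nat.eq_zero_or_pos j with rfl | h0
  · rw [hc.zero, hp.zero]
  rcases le_or_gt j ((s + t) / 2) with h | h
  · exact heq j h0 h
  · have h1 := hc.symm j h0 hj
    have h2 := hp.symm j h0 hj
    have h3 := heq (s + t - j) (by omega) (by omega)
    omega

theorem pathParts_congr {c d : ℕ → ℤ} (h : ∀ j < s + t, c j = d j) :
    pathParts s t c = pathParts s t d := by
  have : pathSet s t c = pathSet s t d := by
    ext z
    refine exists_congr fun j => and_congr_right fun hj => ?_
    rw [h j hj]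
  rw [pathParts, pathParts, this]

theorem bijOn_pathParts (hs : 0 < s) (ht : 0 < t) (hst : Nat.Coprime s t) :
    Set.BijOn (fun T => pathParts s t (pathOf s t T)) (stepSets s t) (doubledSets s t) := by
  refine ⟨fun T hT => (isPath_pathOf hs ht hst hT).pathParts_mem hs ht hst, ?_, fun X hX => ?_⟩
  · intro T hT U hU h
    have hpT := isPath_pathOf hs ht hst hT
    have hpU := isPath_pathOf hs ht hst hU
    have hset : pathSet s t (pathOf s t T) = pathSet s t (pathOf s t U) := by
      rw [← hpT.symmetrize_pathParts hs hst, ← hpU.symmetrize_pathParts hs hst]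
      exact congrArg symmetrize h
    have heq : ∀ j ≤ s + t, pathOf s t T j = pathOf s t U j := fun j hj => by
      have key : ∀ k, pathOf s t T j ≤ k ↔ pathOf s t U j ≤ k := fun k => by
        rw [← hpT.mem_pathSet_iff hs hst hj, hset, hpU.mem_pathSet_iff hs hst hj]
      exact le_antisymm ((key _).2 le_rfl) ((key _).1 le_rfl)
    have hTs := (Finset.mem_powersetCard.1 hT).1
    have hUs := (Finset.mem_powersetCard.1 hU).1
    ext i
    rcases lt_or_ge i ((s + t) / 2 - 1) with hi | hi
    · have h1 := heq (i + 1) (by omega)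
      have h2 := heq (i + 1 + 1) (by omega)
      rw [pathOf_succ (by omega), pathOf_succ (by omega)] at h1 h2
      rw [card_filter_lt_succ, card_filter_lt_succ] at h2
      by_cases hiT : i ∈ T <;> by_cases hiU : i ∈ U <;> simp [hiT, hiU] at h1 h2 ⊢ <;> omega
    · exact iff_of_false (fun h => absurd (Finset.mem_range.1 (hTs h)) (by omega))
        (fun h => absurd (Finset.mem_range.1 (hUs h)) (by omega))
  · obtain ⟨c, hc, rfl⟩ := exists_isPath hs ht hst hX
    obtain ⟨T, hT, h⟩ := hc.exists_eq_pathOf hs ht hst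
    exact ⟨T, hT, (pathParts_congr h).symm⟩

theorem finite_doubledSets (hs : 0 < s) (ht : 0 < t) (hst : Nat.Coprime s t) :
    (doubledSets s t).Finite :=
  (bijOn_pathParts hs ht hst).image_eq ▸ (stepSets s t).finite_toSet.image _

theorem ncard_doubledSets (hs : 0 < s) (ht : 0 < t) (hst : Nat.Coprime s t) :
    (doubledSets s t).ncard = ((s - 1) / 2 + (t - 1) / 2).choose ((s - 1) / 2) := by
  rw [← (bijOn_pathParts hs ht hst).image_eq, (bijOn_pathParts hs ht hst).injOn.ncard_image,
    Set.ncard_coe_finset, stepSets, Finset.card_powersetCard, Finset.card_range,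
    half_add_sub_one hs ht hst]

/-! ### Shifted cores: adjoining half of the even modulus -/

variable {X : Finset ℕ}

theorem IsDoubledSet.isShiftedSet (h : IsDoubledSet s X) : IsShiftedSet s X :=
  ⟨h.1, fun x hx y hy _ => h.2 x hx y hy⟩

/-- For an even modulus `2 * u`, the only obstruction to being a doubled set is the element `u`. -/
theorem IsShiftedSet.isDoubledSet_of_notMem {u : ℕ} (h : IsShiftedSet (2 * u) X) (hu : u ∉ X) :
    IsDoubledSet (2 * u) X := by
  refine ⟨h.1, fun x hx y hy => ?_⟩
  rcases eq_or_ne x y with rfl | hxy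
  · rintro ⟨m, hm⟩
    obtain rfl : x = u * m := by linarith
    rcases Nat.even_or_odd' m with ⟨k, rfl | rfl⟩
    · exact h.1.not_dvd hx ⟨k, by ring⟩
    · have he : u * (2 * k + 1) = u + 2 * u * k := by ring
      have := h.1.sub_mul_mem hx k (by omega)
      rw [he, Nat.add_sub_cancel] at this
      exact hu this
  · exact h.2 x hx y hy hxy

theorem IsShiftedSet.isDoubledSet_of_odd (h : IsShiftedSet s X) (hs : Odd s) :
    IsDoubledSet s X := by
  refine ⟨h.1, fun x hx y hy => ?_⟩
  rcases eq_or_ne x y with rfl | hxy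
  · intro hd
    rw [← two_mul] at hd
    exact h.1.not_dvd hx ((Nat.Coprime.dvd_mul_left hs.coprime_two_right).1 hd)
  · exact h.2 x hx y hy hxy

theorem isShiftedSet_iff_of_odd (hs : Odd s) : IsShiftedSet s X ↔ IsDoubledSet s X :=
  ⟨fun h => h.isDoubledSet_of_odd hs, IsDoubledSet.isShiftedSet⟩

theorem shiftedSets_comm (s t : ℕ) : shiftedSets s t = shiftedSets t s :=
  Set.ext fun _ => and_comm

theorem shiftedSets_of_odd (hs : Odd s) (ht : Odd t) : shiftedSets s t = doubledSets s t :=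
  Set.ext fun _ => and_congr (isShiftedSet_iff_of_odd hs) (isShiftedSet_iff_of_odd ht)

theorem shiftedSets_one_right (s : ℕ) : shiftedSets s 1 = {∅} := by
  ext X
  constructor
  · intro hX
    exact Finset.eq_empty_of_forall_notMem fun x hx => hX.2.1.not_dvd hx (one_dvd x)
  · rintro rfl
    simp [shiftedSets, IsShiftedSet, IsDescending]

/-- The sets to which half of the even modulus can be adjoined. -/
def extendableSets (u t : ℕ) : Set (Finset ℕ) :=
  {X | X ∈ doubledSets (2 * u) t ∧ (t : ℤ) - u ∉ symmetrize X}

variable {u : ℕ}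

theorem notMem_of_isDoubledSet (hX : IsDoubledSet (2 * u) X) : u ∉ X := fun h =>
  hX.2 u h u h ⟨1, by ring⟩

theorem erase_mem_extendableSets (ht : Odd t) (hX : X ∈ shiftedSets (2 * u) t)
    (huX : u ∈ X) : X.erase u ∈ extendableSets u t := by
  obtain ⟨⟨⟨h0, h1⟩, h2⟩, hX2⟩ := hX
  have hX2' := hX2.isDoubledSet_of_odd ht
  have htu : t ≠ u := fun h => hX2.1.not_dvd huX (h ▸ dvd_rfl)
  have hu' : u ∉ X.erase u := Finset.notMem_erase u X
  have hs : IsShiftedSet (2 * u) (X.erase u) := by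
    refine ⟨⟨fun h => h0 (Finset.mem_of_mem_erase h), fun x hx hsx => ?_⟩, fun x hx y hy hxy =>
      h2 x (Finset.mem_of_mem_erase hx) y (Finset.mem_of_mem_erase hy) hxy⟩
    obtain ⟨hxu, hx⟩ := Finset.mem_erase.1 hx
    refine Finset.mem_erase.2 ⟨fun hc => ?_, h1 x hx hsx⟩
    exact h2 x hx u huX hxu ⟨2, by omega⟩
  have ht' : IsDoubledSet t (X.erase u) := by
    refine ⟨⟨fun h => h0 (Finset.mem_of_mem_erase h), fun x hx htx => ?_⟩, fun x hx y hy =>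
      hX2'.2 x (Finset.mem_of_mem_erase hx) y (Finset.mem_of_mem_erase hy)⟩
    obtain ⟨hxu, hx⟩ := Finset.mem_erase.1 hx
    refine Finset.mem_erase.2 ⟨fun hc => ?_, hX2.1.2 x hx htx⟩
    -- Here `x = u + t`, and one of `t - u`, `u - t` is in `X`; it adds up to a multiple of `t` with
    -- `u`, or to `2 * u` with `x`.
    rcases lt_or_gt_of_ne htu with hlt | hlt
    · exact h2 x hx (u - t) (hX2.1.2 u huX hlt.le) (by omega) ⟨1, by omega⟩
    · have := h1 x hx (by omega)
      exact hX2'.2 _ this u huX ⟨1, by omega⟩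
  refine ⟨⟨hs.isDoubledSet_of_notMem hu', ht'⟩, ?_⟩
  rcases lt_or_gt_of_ne htu with hlt | hlt
  · rw [show (t : ℤ) - u = -((u - t : ℕ) : ℤ) by omega, neg_natCast_mem_symmetrize (by omega),
      not_not]
    have htpos := ht.pos
    exact Finset.mem_erase.2 ⟨by omega, hX2.1.2 u huX hlt.le⟩
  · rw [show (t : ℤ) - u = ((t - u : ℕ) : ℤ) by omega, natCast_mem_symmetrize (by omega)]
    intro hc
    exact hX2'.2 _ (Finset.mem_of_mem_erase hc) u huX ⟨1, by omega⟩

theorem insert_mem_shiftedSets (hu : 0 < u) (ht : Odd t) (hX : X ∈ extendableSets u t) :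
    insert u X ∈ shiftedSets (2 * u) t := by
  obtain ⟨⟨hX1, hX2⟩, hM⟩ := hX
  have h0 : 0 ∉ insert u X := by
    rw [Finset.mem_insert]
    rintro (h | h)
    · omega
    · exact hX1.1.1 h
  -- A sum condition for `insert u X` only has to be checked for `u` and an element of `X`.
  have hsum : ∀ r, IsDoubledSet r X → (∀ y ∈ X, ¬ r ∣ u + y) →
      ∀ x ∈ insert u X, ∀ y ∈ insert u X, x ≠ y → ¬ r ∣ x + y := by
    intro r hr h x hx y hy hxy
    rcases Finset.mem_insert.1 hx with rfl | hx' <;> rcases Finset.mem_insert.1 hy with rfl | hy'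
    · exact absurd rfl hxy
    · exact h y hy'
    · rw [add_comm]
      exact h x hx'
    · exact hr.2 x hx' y hy'
  refine ⟨⟨⟨h0, fun x hx hsx => ?_⟩, hsum _ hX1 fun y hy => ?_⟩,
    ⟨⟨h0, fun x hx htx => ?_⟩, hsum _ hX2 fun y hy => ?_⟩⟩
  · rcases Finset.mem_insert.1 hx with rfl | hx
    · omega
    · exact Finset.mem_insert_of_mem (hX1.1.2 x hx hsx)
  · rintro ⟨m, hm⟩
    rcases m with _ | m
    · omega
    · rw [Nat.mul_succ] at hm
      have := hX1.1.sub_mul_mem hy m (by omega)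
      rw [show y - 2 * u * m = u by omega] at this
      exact notMem_of_isDoubledSet hX1 this
  · rcases Finset.mem_insert.1 hx with rfl | hx
    · rcases htx.eq_or_lt with rfl | hlt
      · rw [sub_self] at hM
        exact absurd (zero_mem_symmetrize X) hM
      · rw [show (t : ℤ) - x = -((x - t : ℕ) : ℤ) by omega,
          neg_natCast_mem_symmetrize (by omega), not_not] at hM
        exact Finset.mem_insert_of_mem hM
    · exact Finset.mem_insert_of_mem (hX2.1.2 x hx htx)
  · rintro ⟨m, hm⟩
    rcases m with _ | m
    · omega
    · have hy0 : 0 < y := Nat.pos_of_ne_zero fun h => hX1.1.1 (h ▸ hy)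
      have := sub_mul_mem ((isDoubledSet_iff ht.pos).1 hX2).2
        ((natCast_mem_symmetrize hy0).2 hy) m
      rw [show (y : ℤ) - t * m = t - u by
        have : (u : ℤ) + y = t * ((m + 1 : ℕ) : ℤ) := by exact_mod_cast hm
        push_cast at this
        linarith] at this
      exact hM this

theorem shiftedSets_two_mul (hu : 0 < u) (ht : Odd t) :
    shiftedSets (2 * u) t = doubledSets (2 * u) t ∪ insert u '' extendableSets u t := by
  ext X
  constructor
  · intro hX
    by_cases huX : u ∈ X
    · exact Or.inr ⟨X.erase u, erase_mem_extendableSets ht hX huX, Finset.insert_erase huX⟩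
    · exact Or.inl ⟨hX.1.isDoubledSet_of_notMem huX, hX.2.isDoubledSet_of_odd ht⟩
  · rintro (hX | ⟨Y, hY, rfl⟩)
    · exact ⟨hX.1.isShiftedSet, hX.2.isShiftedSet⟩
    · exact insert_mem_shiftedSets hu ht hY

/-- The point `t - u` lies over the last but one index of the first half of a period, so it decides
about the last increment there. -/
theorem pathParts_mem_extendableSets_iff (hu : 0 < u) (ht : 1 < t)
    (hst : Nat.Coprime (2 * u) t) {T : Finset ℕ} (hT : T ∈ stepSets (2 * u) t) :
    pathParts (2 * u) t (pathOf (2 * u) t T) ∈ extendableSets u t ↔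
      T ⊆ Finset.range ((2 * u + t) / 2 - 2) := by
  have hodd : ¬ 2 ∣ t := fun h =>
    Nat.not_coprime_of_dvd_of_dvd one_lt_two (Dvd.intro u rfl) h hst
  have hp := isPath_pathOf (s := 2 * u) (by omega) (by omega) hst hT
  have hmem := hp.pathParts_mem (by omega) (by omega) hst
  obtain ⟨hsub, hcard⟩ := Finset.mem_powersetCard.1 hT
  have hcut := card_filter_lt_succ T ((2 * u + t) / 2 - 2)
  rw [show (2 * u + t) / 2 - 2 + 1 = (2 * u + t) / 2 - 1 by omega, filter_lt_eq_self hsub,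
    hcard] at hcut
  have hz : (t : ℤ) - u = (((2 * u + t) / 2 - 2 + 1 : ℕ) : ℤ) * ((2 * u : ℕ) : ℤ)
      - ((2 * u + t : ℕ) : ℤ) * (u - 1) := by
    rw [show (((2 * u + t) / 2 - 2 + 1 : ℕ) : ℤ) * ((2 * u : ℕ) : ℤ)
      = (2 * (((2 * u + t) / 2 - 2 + 1 : ℕ) : ℤ)) * u by push_cast; ring,
      show 2 * (((2 * u + t) / 2 - 2 + 1 : ℕ) : ℤ) = 2 * u + t - 3 by omega]
    push_cast
    ring
  rw [extendableSets, Set.mem_ofPred_eq, and_iff_right hmem,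
    hp.symmetrize_pathParts (by omega) hst, hz, hp.mem_pathSet_iff (by omega) hst (by omega),
    pathOf_succ (by omega)]
  have hlast : T ⊆ Finset.range ((2 * u + t) / 2 - 2) ↔ (2 * u + t) / 2 - 2 ∉ T := by
    constructor
    · exact fun h hc => absurd (Finset.mem_range.1 (h hc)) (lt_irrefl _)
    · intro h x hx
      have h1 := Finset.mem_range.1 (hsub hx)
      have h2 : x ≠ (2 * u + t) / 2 - 2 := fun he => h (he ▸ hx)
      exact Finset.mem_range.2 (by omega)
  rw [hlast]
  split_ifs at hcut with h
  · simp only [h, not_true, iff_false, not_not]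
    omega
  · simp only [h, not_false_eq_true, iff_true]
    omega

theorem ncard_extendableSets (hu : 0 < u) (ht : 1 < t) (hst : Nat.Coprime (2 * u) t) :
    (extendableSets u t).ncard = (u - 1 + (t - 1) / 2 - 1).choose (u - 1) := by
  have hbij := bijOn_pathParts (s := 2 * u) (by omega) (by omega) hst
  have hhalf := half_add_sub_one (s := 2 * u) (by omega) (by omega) hst
  have hsub : Finset.powersetCard ((2 * u - 1) / 2) (Finset.range ((2 * u + t) / 2 - 2))
      ⊆ stepSets (2 * u) t :=
    Finset.powersetCard_mono (Finset.range_subset_range.2 (by omega))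
  have himage : (fun T => pathParts (2 * u) t (pathOf (2 * u) t T)) ''
      (Finset.powersetCard ((2 * u - 1) / 2) (Finset.range ((2 * u + t) / 2 - 2)) :
        Finset (Finset ℕ)) = extendableSets u t := by
    ext X
    constructor
    · rintro ⟨T, hT, rfl⟩
      exact (pathParts_mem_extendableSets_iff hu ht hst (hsub hT)).2
        (Finset.mem_powersetCard.1 hT).1
    · intro hX
      obtain ⟨T, hT, rfl⟩ := hbij.surjOn hX.1
      exact ⟨T, Finset.mem_powersetCard.2 ⟨(pathParts_mem_extendableSets_iff hu ht hst hT).1 hX,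
        (Finset.mem_powersetCard.1 hT).2⟩, rfl⟩
  rw [← himage, (hbij.injOn.mono (by exact_mod_cast hsub)).ncard_image, Set.ncard_coe_finset,
    Finset.card_powersetCard, Finset.card_range]
  congr 1 <;> omega

theorem ncard_shiftedSets_two_mul (hu : 0 < u) (ht : 1 < t) (hst : Nat.Coprime (2 * u) t) :
    (shiftedSets (2 * u) t).ncard =
      (u - 1 + (t - 1) / 2).choose (u - 1) + (u - 1 + (t - 1) / 2 - 1).choose (u - 1) := by
  have hfin := finite_doubledSets (s := 2 * u) (by omega) (by omega) hst
  have hfin' : (extendableSets u t).Finite := hfin.subset fun X hX => hX.1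
  have hodd : Odd t := Nat.Coprime.odd_of_left (hst.coprime_dvd_left (Dvd.intro u rfl))
  rw [shiftedSets_two_mul hu hodd, Set.ncard_union_eq _ hfin (hfin'.image _),
    ncard_doubledSets (by omega) (by omega) hst, Set.InjOn.ncard_image,
    ncard_extendableSets hu ht hst]
  · rw [show (2 * u - 1) / 2 = u - 1 by omega]
  · intro X hX Y hY hXY
    rw [← Finset.erase_insert (notMem_of_isDoubledSet hX.1.1), hXY,
      Finset.erase_insert (notMem_of_isDoubledSet hY.1.1)]
  · rw [Set.disjoint_left]
    rintro _ hX ⟨Y, _, rfl⟩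
    exact notMem_of_isDoubledSet hX.1 (Finset.mem_insert_self u Y)

theorem finite_shiftedSets (hs : 0 < s) (ht : 0 < t) (hst : Nat.Coprime s t) :
    (shiftedSets s t).Finite := by
  have key : ∀ {u t : ℕ}, 0 < u → 0 < t → Nat.Coprime (2 * u) t →
      (shiftedSets (2 * u) t).Finite := fun {u t} hu ht hst => by
    have hfin := finite_doubledSets (s := 2 * u) (by omega) ht hst
    rw [shiftedSets_two_mul hu (Nat.Coprime.odd_of_left (hst.coprime_dvd_left (Dvd.intro u rfl)))]
    exact hfin.union ((hfin.subset fun X hX => hX.1).image _)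
  rcases Nat.even_or_odd' s with ⟨u, rfl | hs'⟩
  · exact key (by omega) ht hst
  rcases Nat.even_or_odd' t with ⟨u, rfl | ht'⟩
  · rw [shiftedSets_comm]
    exact key (by omega) hs hst.symm
  · rw [shiftedSets_of_odd ⟨_, hs'⟩ ⟨_, ht'⟩]
    exact finite_doubledSets hs ht hst

/-! ### The enumeration -/

theorem binom_sub_one {m k : ℕ} (hm : 0 < m) : binom ((m : ℤ) - 1) k = (m - 1).choose k := by
  rw [binom, if_neg (by omega), show ((m : ℤ) - 1).toNat = m - 1 by omega]

theorem binom_natCast_sub_one_self (m : ℕ) : binom ((m : ℤ) - 1) m = 0 := by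
  rcases Nat.eq_zero_or_pos m with rfl | hm
  · rfl
  · rw [binom_sub_one hm, Nat.choose_eq_zero_of_lt (by omega)]

theorem ncard_shiftedSets_even (hu : 0 < u) (ht : 0 < t) (hst : Nat.Coprime (2 * u) t) :
    (shiftedSets (2 * u) t).ncard =
      binom (((2 * u - 1) / 2 + t / 2 : ℕ) - 1 : ℤ) ((2 * u - 1) / 2) +
      binom ((2 * u / 2 + (t - 1) / 2 : ℕ) - 1 : ℤ) ((t - 1) / 2) := by
  obtain ⟨b, rfl⟩ : Odd t := Nat.Coprime.odd_of_left (hst.coprime_dvd_left (Dvd.intro u rfl))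
  rw [show (2 * u - 1) / 2 = u - 1 by omega, show 2 * u / 2 = u by omega,
    show (2 * b + 1) / 2 = b by omega, show (2 * b + 1 - 1) / 2 = b by omega]
  rcases Nat.eq_zero_or_pos b with rfl | hb
  · rw [mul_zero, zero_add, shiftedSets_one_right, Set.ncard_singleton, add_zero,
      binom_natCast_sub_one_self, binom_sub_one (by omega), Nat.choose_zero_right]
  · rw [ncard_shiftedSets_two_mul hu (by omega) hst, show (2 * b + 1 - 1) / 2 = b by omega,
      binom_sub_one (by omega), binom_sub_one (by omega), add_comm,
      show u + b - 1 = u - 1 + b by omega, Nat.choose_symm_add]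

theorem ncard_shiftedSets (hs : 0 < s) (ht : 0 < t) (hst : Nat.Coprime s t)
    (h1 : ¬ (s = 1 ∧ t = 1)) :
    (shiftedSets s t).ncard =
      binom (((s - 1) / 2 + t / 2 : ℕ) - 1 : ℤ) ((s - 1) / 2) +
      binom ((s / 2 + (t - 1) / 2 : ℕ) - 1 : ℤ) ((t - 1) / 2) := by
  rcases Nat.even_or_odd' s with ⟨u, rfl | rfl⟩
  · exact ncard_shiftedSets_even (by omega) ht hst
  rcases Nat.even_or_odd' t with ⟨v, rfl | rfl⟩
  · rw [shiftedSets_comm, ncard_shiftedSets_even (by omega) hs hst.symm, add_comm,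
      add_comm (2 * v / 2), add_comm ((2 * v - 1) / 2)]
  · rw [shiftedSets_of_odd ⟨u, rfl⟩ ⟨v, rfl⟩, ncard_doubledSets hs ht hst,
      show (2 * u + 1 - 1) / 2 = u by omega, show (2 * v + 1 - 1) / 2 = v by omega,
      show (2 * u + 1) / 2 = u by omega, show (2 * v + 1) / 2 = v by omega,
      binom_sub_one (by omega), binom_sub_one (by omega)]
    -- Both parities are odd: the two terms add up by Pascal's rule.
    rcases u with _ | u
    · rw [Nat.choose_zero_right, Nat.choose_zero_right, Nat.choose_eq_zero_of_lt (by omega)]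
    · rw [show u + 1 + v = u + v + 1 by ring, Nat.choose_succ_succ', Nat.add_sub_cancel,
        ← Nat.choose_symm_add (a := u) (b := v), add_comm]

end ShiftedCores

theorem theorem1p1 (s t : ℕ) (hs : 0 < s) (ht : 0 < t) (hst : Nat.Coprime s t) :
    ((ShiftedCores.DD s t).Finite ∧
      (ShiftedCores.DD s t).ncard = ((s - 1) / 2 + (t - 1) / 2).choose ((s - 1) / 2)) ∧
    ((ShiftedCores.CS s t).Finite ∧
      (¬ (s = 1 ∧ t = 1) →
        (ShiftedCores.CS s t).ncard =
          ShiftedCores.binom (((s - 1) / 2 + t / 2 : ℕ) - 1 : ℤ) ((s - 1) / 2) +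
          ShiftedCores.binom ((s / 2 + (t - 1) / 2 : ℕ) - 1 : ℤ) ((t - 1) / 2))) := by
  obtain ⟨f, hf⟩ := ShiftedCores.exists_bijOn_DD hs ht
  have hg := ShiftedCores.bijOn_parts_CS hs ht
  refine ⟨⟨?_, ?_⟩, ?_, fun h1 => ?_⟩
  · rw [← hf.image_eq]
    exact (ShiftedCores.finite_doubledSets hs ht hst).image f
  · rw [← hf.image_eq, hf.injOn.ncard_image, ShiftedCores.ncard_doubledSets hs ht hst]
  · refine Set.Finite.of_finite_image ?_ hg.injOn
    rw [hg.image_eq]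
    exact ShiftedCores.finite_shiftedSets hs ht hst
  · rw [← hg.injOn.ncard_image, hg.image_eq, ShiftedCores.ncard_shiftedSets hs ht hst h1]
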